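/- Let $N\ge 1$ be an integer, and let $0<s\le 1$ and $1<p<\infty$ satisfy $sp>N$. Put $\alpha_{s,p}=s-\frac{N}{p}$. For $\varphi:\mathbb{R}^N\to\mathbb{R}$ define $$[\varphi]_{C^{0,\alpha_{s,p}}(\mathbb{R}^N)}=\sup_{x,y\in\mathbb{R}^N,\;x\neq y}\frac{|\varphi(x)-\varphi(y)|}{|x-y|^{\alpha_{s,p}}}$$ and $$[\varphi]_{W^{s,p}(\mathbb{R}^N)}=\begin{cases}\displaystyle\left(\iint_{\mathbb{R}^N\times\mathbb{R}^N}\frac{|\varphi(x)-\varphi(y)|^p}{|x-y|^{N+sp}}\,dx\,dy\right)^{1/p}, & 0<s<1,\\[2mm] \displaystyle\left(\int_{\mathbb{R}^N}|\nabla\varphi|^p\,dx\right)^{1/p}, & s=1,\end{cases}$$ where $\nabla\varphi$ is the weak gradient of $\varphi$ (and $[\varphi]_{W^{1,p}(\mathbb{R}^N)}=+\infty$ if $\varphi$ has no locally integrable weak gradient). Let $\mathcal{W}^{s,p}(\mathbb{R}^N)$ be the set of all continuous functions $\varphi:\mathbb{R}^N\to\mathbb{R}$ with $[\varphi]_{C^{0,\alpha_{s,p}}(\mathbb{R}^N)}<+\infty$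 and $[\varphi]_{W^{s,p}(\mathbb{R}^N)}<+\infty$. Then for every $\varphi\in\mathcal{W}^{s,p}(\mathbb{R}^N)$ there exist two distinct points $x_0,y_0\in\mathbb{R}^N$ such that $$[\varphi]_{C^{0,\alpha_{s,p}}(\mathbb{R}^N)}=\frac{|\varphi(x_0)-\varphi(y_0)|}{|x_0-y_0|^{\alpha_{s,p}}}.$$ -/

import Mathlib

open MeasureTheory Set
open scoped ENNReal ContDiff

noncomputable section

/-- The exponent `α = s - N / p`. -/
def alphaExp (N : ℕ) (s p : ℝ) : ℝ := s - N / p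

/-- The Hölder quotient `|φ x - φ y| / |x - y| ^ α`. -/
def holderQuotient {N : ℕ} (α : ℝ) (φ : EuclideanSpace ℝ (Fin N) → ℝ)
    (x y : EuclideanSpace ℝ (Fin N)) : ℝ :=
  |φ x - φ y| / ‖x - y‖ ^ α

/-- The Hölder seminorm: the supremum, in `[0, ∞]`, of the Hölder quotients over
all pairs of distinct points. -/
def holderSeminorm {N : ℕ} (α : ℝ) (φ : EuclideanSpace ℝ (Fin N) → ℝ) : ℝ≥0∞ :=
  ⨆ (x : EuclideanSpace ℝ (Fin N)) (y : EuclideanSpace ℝ (Fin N)) (_ : x ≠ y),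
    ENNReal.ofReal (holderQuotient α φ x y)

/-- The Sobolev-Slobodeckii (Gagliardo) seminorm, with values in `[0, ∞]`. -/
def gagliardoSeminorm {N : ℕ} (s p : ℝ) (φ : EuclideanSpace ℝ (Fin N) → ℝ) : ℝ≥0∞ :=
  (∫⁻ z : EuclideanSpace ℝ (Fin N) × EuclideanSpace ℝ (Fin N),
    ENNReal.ofReal (|φ z.1 - φ z.2| ^ p / ‖z.1 - z.2‖ ^ (N + s * p))) ^ (1 / p)

/-- `g` is the weak (distributional) gradient of `φ`: both are locally integrable, and
`∫ φ ∂ᵢψ = - ∫ gᵢ ψ` for every coordinate `i` and every test function `ψ ∈ C_c^∞`. -/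
def IsWeakGradient {N : ℕ} (φ : EuclideanSpace ℝ (Fin N) → ℝ)
    (g : EuclideanSpace ℝ (Fin N) → EuclideanSpace ℝ (Fin N)) : Prop :=
  LocallyIntegrable φ ∧ LocallyIntegrable g ∧
    ∀ ψ : EuclideanSpace ℝ (Fin N) → ℝ, ContDiff ℝ ∞ ψ → HasCompactSupport ψ →
      ∀ i : Fin N, ∫ x, φ x * fderiv ℝ ψ x (EuclideanSpace.single i 1) = - ∫ x, g x i * ψ x

/-- The `L^p` norm of the weak gradient, with values in `[0, ∞]`. Weak gradients are unique up to
null sets, so the infimum is over equal values; it is `∞` if there is no weak gradient. -/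
def gradientSeminorm {N : ℕ} (p : ℝ) (φ : EuclideanSpace ℝ (Fin N) → ℝ) : ℝ≥0∞ :=
  ⨅ (g : EuclideanSpace ℝ (Fin N) → EuclideanSpace ℝ (Fin N)) (_ : IsWeakGradient φ g),
    (∫⁻ x, ENNReal.ofReal (‖g x‖ ^ p)) ^ (1 / p)

/-- The seminorm `[φ]_{W^{s,p}(ℝ^N)}` for `0 < s ≤ 1`. -/
def sobolevSeminorm {N : ℕ} (s p : ℝ) (φ : EuclideanSpace ℝ (Fin N) → ℝ) : ℝ≥0∞ :=
  open Classical in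
  if s = 1 then gradientSeminorm p φ else gagliardoSeminorm s p φ

/-- The homogeneous Hölder space `Ċ^{0,α}(ℝ^N)`. -/
def homHolderSpace (N : ℕ) (α : ℝ) : Set (EuclideanSpace ℝ (Fin N) → ℝ) :=
  {φ | Continuous φ ∧ holderSeminorm α φ < (⊤ : ℝ≥0∞)}

/-- The space `𝒲^{s,p}(ℝ^N)`: functions in `Ċ^{0,α}(ℝ^N)`, with `α = s - N / p`, whose
`W^{s,p}` seminorm is finite. -/
def homSobolevSpace (N : ℕ) (s p : ℝ) : Set (EuclideanSpace ℝ (Fin N) → ℝ) :=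
  {φ | φ ∈ homHolderSpace N (alphaExp N s p) ∧ sobolevSeminorm s p φ < (⊤ : ℝ≥0∞)}

end

/-!
Write `Q x y` for the Hölder quotient of `φ`, with `α = s - N / p`. The supremum of `Q` is attained
as soon as, for each `ε > 0`, the pairs with `ε ≤ Q x y` stay in a compact set of pairs that avoids
the diagonal: the distance `d = ‖x - y‖` is bounded above and away from zero, and `x` is bounded
(`exists_holderSeminorm_eq_of_confined`). The Sobolev seminorm provides this confinement: it has the
same scaling as the Hölder seminorm, so every pair with a large quotient carries a fixed amount of
energy near it at scale `d`, while the total energy is a finite measure, which escapes neither to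
small scales, nor to large scales, nor to infinity. A Morrey inequality is not needed, because the
finiteness of the Hölder seminorm is part of the hypothesis.

For `s < 1`: if `ε ≤ Q x y` and `δ` is small, Hölder continuity gives
`ε / 2 * d ^ α ≤ |φ u - φ v|` for all `u ∈ B(x, δ d)` and `v ∈ B(y, δ d)`
(`le_abs_sub_of_mem_ball`). Integrating the Gagliardo density over the product of the two balls, all
powers of `d` cancel and the product has energy at least a constant `c > 0`. But the set of pairs
`(u, v)` where `‖u - v‖ + ‖u - v‖⁻¹ + ‖u‖` is at least `R` has energy less than `c` when `R` is
large, so the product contains a pair outside that set, which confines `x` and `d`.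

For `s = 1`: mollify `φ` at scale `δ d`. This changes the values by at most a small multiple of
`d ^ α`, and the gradient of the mollification is at most a constant times `d ^ (-N) * ∫ ‖∇φ‖` over
a ball (`IsWeakGradient.abs_sub_le`). Hence `ε ≤ Q x y` forces
`c * d ^ (N - N / p) ≤ ∫ ‖∇φ‖` over `B(x, 2 d)`, with a constant `c > 0`. The part of this integral
over the set where `‖w‖ + ‖∇φ w‖` is at least a large `R` is less than half of the left side, by
Hölder's inequality; the rest is at most `R` times the volume of `B(x, 2 d) ∩ B(0, R)`, which is too
small unless `d` and `x` are confined (`confined_of_le_lintegral_closedBall`).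
-/

/-! ### Hölder quotients and attainment of the supremum -/

theorem holderQuotient_nonneg {N : ℕ} (α : ℝ) (φ : EuclideanSpace ℝ (Fin N) → ℝ)
    (x y : EuclideanSpace ℝ (Fin N)) : 0 ≤ holderQuotient α φ x y := by
  unfold holderQuotient; positivity

theorem ofReal_holderQuotient_le_holderSeminorm {N : ℕ} (α : ℝ)
    (φ : EuclideanSpace ℝ (Fin N) → ℝ) {x y : EuclideanSpace ℝ (Fin N)} (h : x ≠ y) :
    ENNReal.ofReal (holderQuotient α φ x y) ≤ holderSeminorm α φ :=
  le_iSup_of_le x (le_iSup_of_le y (le_iSup_of_le h le_rfl))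

theorem abs_sub_le_of_holderSeminorm_lt_top {N : ℕ} {α : ℝ} {φ : EuclideanSpace ℝ (Fin N) → ℝ}
    (h : holderSeminorm α φ < ⊤) (x y : EuclideanSpace ℝ (Fin N)) :
    |φ x - φ y| ≤ (holderSeminorm α φ).toReal * ‖x - y‖ ^ α := by
  rcases eq_or_ne x y with rfl | hxy
  · simp only [sub_self, abs_zero]; positivity
  have h1 := ENNReal.ofReal_le_iff_le_toReal h.ne |>.1
    (ofReal_holderQuotient_le_holderSeminorm α φ hxy)
  have hd : 0 < ‖x - y‖ := norm_pos_iff.2 (sub_ne_zero.2 hxy)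
  rwa [holderQuotient, div_le_iff₀ (by positivity)] at h1

/-- The Hölder quotient is continuous off the diagonal, so it is enough to maximize it over a compact
set that contains all pairs whose quotient is at least that of one given pair. -/
theorem exists_holderSeminorm_eq_of_confined {N : ℕ} (hN : 1 ≤ N) {α : ℝ}
    {φ : EuclideanSpace ℝ (Fin N) → ℝ} (hφ : Continuous φ)
    (hconf : ∀ ε > 0, ∃ R > 0, ∀ x y, x ≠ y → ε ≤ holderQuotient α φ x y →
      1 / R ≤ ‖x - y‖ ∧ ‖x - y‖ ≤ R ∧ ‖x‖ ≤ R) :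
    ∃ x₀ y₀ : EuclideanSpace ℝ (Fin N), x₀ ≠ y₀ ∧
      holderSeminorm α φ = ENNReal.ofReal (holderQuotient α φ x₀ y₀) := by
  -- It suffices to find a pair that maximizes the quotient.
  suffices ∃ x₀ y₀ : EuclideanSpace ℝ (Fin N), x₀ ≠ y₀ ∧
      ∀ x y, x ≠ y → holderQuotient α φ x y ≤ holderQuotient α φ x₀ y₀ by
    obtain ⟨x₀, y₀, hne, hmax⟩ := this
    exact ⟨x₀, y₀, hne, le_antisymm
      (iSup_le fun x => iSup_le fun y => iSup_le fun h => ENNReal.ofReal_le_ofReal (hmax x y h))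
      (ofReal_holderQuotient_le_holderSeminorm α φ hne)⟩
  by_cases hpos : ∃ x₁ y₁ : EuclideanSpace ℝ (Fin N), x₁ ≠ y₁ ∧ 0 < holderQuotient α φ x₁ y₁
  · obtain ⟨x₁, y₁, hne, hq⟩ := hpos
    obtain ⟨R, hR, hconf⟩ := hconf _ hq
    set K : Set (EuclideanSpace ℝ (Fin N) × EuclideanSpace ℝ (Fin N)) :=
      {z | 1 / R ≤ ‖z.1 - z.2‖ ∧ ‖z.1 - z.2‖ ≤ R ∧ ‖z.1‖ ≤ R} with hK
    have hKne : ∀ z ∈ K, 0 < ‖z.1 - z.2‖ := fun z hz => lt_of_lt_of_le (by positivity) hz.1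
    have hKc : IsCompact K := by
      refine Metric.isCompact_of_isClosed_isBounded ?_ ?_
      · have h1 : Continuous fun z : EuclideanSpace ℝ (Fin N) × EuclideanSpace ℝ (Fin N) =>
            ‖z.1 - z.2‖ := by fun_prop
        exact (isClosed_le continuous_const h1).inter
          ((isClosed_le h1 continuous_const).inter
            (isClosed_le continuous_fst.norm continuous_const))
      · refine (Metric.isBounded_closedBall (x := (0 : _ × _)) (r := 2 * R)).subset ?_
        rintro ⟨u, v⟩ ⟨-, h2, h3⟩
        have h4 : ‖v‖ ≤ ‖u‖ + ‖u - v‖ := by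
          simpa using norm_sub_le u (u - v)
        simp only at h2 h3
        simp only [mem_closedBall_zero_iff, Prod.norm_def, max_le_iff]
        constructor <;> linarith
    have hcont : ContinuousOn (fun z : EuclideanSpace ℝ (Fin N) × EuclideanSpace ℝ (Fin N) =>
        holderQuotient α φ z.1 z.2) K := by
      unfold holderQuotient
      refine ContinuousOn.div (by fun_prop) ?_ fun z hz => (Real.rpow_pos_of_pos (hKne z hz) _).ne'
      exact ContinuousOn.rpow_const (by fun_prop) fun z hz => Or.inl (hKne z hz).ne'
    obtain ⟨z, hz, hmax⟩ := hKc.exists_isMaxOn ⟨(x₁, y₁), hconf x₁ y₁ hne le_rfl⟩ hcont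
    have hmax' : ∀ w ∈ K, holderQuotient α φ w.1 w.2 ≤ holderQuotient α φ z.1 z.2 := hmax
    refine ⟨z.1, z.2, sub_ne_zero.1 (norm_pos_iff.1 (hKne z hz)), fun x y hxy => ?_⟩
    rcases le_total (holderQuotient α φ x₁ y₁) (holderQuotient α φ x y) with h | h
    · exact hmax' (x, y) (hconf x y hxy h)
    · exact h.trans (hmax' (x₁, y₁) (hconf x₁ y₁ hne le_rfl))
  -- If no quotient is positive, every pair is a maximizer.
  · push Not at hpos
    have : NeZero N := ⟨by omega⟩
    refine ⟨EuclideanSpace.single 0 1, 0, ?_, fun x y hxy =>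
      (hpos x y hxy).trans (holderQuotient_nonneg _ _ _ _)⟩
    exact norm_ne_zero_iff.1 (by simp)

/-! ### Auxiliary estimates -/

theorem exists_measure_ge_lt {X : Type*} [MeasurableSpace X] (ν : Measure X) [IsFiniteMeasure ν]
    {f : X → ℝ} (hf : AEMeasurable f ν) {c : ℝ≥0∞} (hc : 0 < c) :
    ∃ R : ℝ, 0 < R ∧ ν {z | R ≤ f z} < c := by
  have h := tendsto_measure_iInter_atTop (μ := ν) (s := fun R : ℝ => {z | R ≤ f z})
    (fun R => nullMeasurableSet_le aemeasurable_const hf)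
    (fun a b hab z hz => le_trans hab hz) ⟨0, measure_ne_top _ _⟩
  have h0 : (⋂ R : ℝ, {z | R ≤ f z}) = ∅ := by
    refine eq_empty_of_forall_notMem fun z hz => ?_
    have := mem_iInter.1 hz (f z + 1)
    simp only [mem_ofPred_eq] at this
    linarith
  rw [h0, measure_empty] at h
  obtain ⟨R, h1, h2⟩ := ((h.eventually (gt_mem_nhds hc)).and (Filter.eventually_gt_atTop 0)).exists
  exact ⟨R, h2, h1⟩

theorem exists_pos_le_quarter_mul_rpow_le {α H ε : ℝ} (hα : 0 < α) (hε : 0 < ε) :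
    ∃ δ : ℝ, 0 < δ ∧ δ ≤ 1 / 4 ∧ H * δ ^ α ≤ ε := by
  have h : Filter.Tendsto (fun δ : ℝ => H * δ ^ α) (nhdsWithin 0 (Ioi 0)) (nhds 0) := by
    have : ContinuousAt (fun δ : ℝ => H * δ ^ α) 0 :=
      continuousAt_const.mul (Real.continuousAt_rpow_const _ _ (Or.inr hα.le))
    have h := this.tendsto
    simp only [Real.zero_rpow hα.ne', mul_zero] at h
    exact h.mono_left nhdsWithin_le_nhds
  obtain ⟨δ, ⟨h1, h2⟩, h3⟩ := ((h.eventually (ge_mem_nhds hε)).and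
    (Ioc_mem_nhdsGT (show (0 : ℝ) < 1 / 4 by norm_num))).exists
    |>.imp fun δ h => (⟨⟨h.1, h.2.1⟩, h.2.2⟩ : (H * δ ^ α ≤ ε ∧ 0 < δ) ∧ δ ≤ 1 / 4)
  exact ⟨δ, h2, h3, h1⟩

/-- A lower bound for the quotient of one pair passes to nearby pairs, at the scale of the pair. -/
theorem le_abs_sub_of_mem_ball {N : ℕ} {α H ε δ : ℝ} {φ : EuclideanSpace ℝ (Fin N) → ℝ}
    (hα : 0 < α) (hH : 0 ≤ H) (hφ : ∀ x y, |φ x - φ y| ≤ H * ‖x - y‖ ^ α)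
    (hδ : 0 < δ) (hδH : H * δ ^ α ≤ ε / 4) {x y u v : EuclideanSpace ℝ (Fin N)} (hxy : x ≠ y)
    (hq : ε ≤ holderQuotient α φ x y) (hu : ‖u - x‖ ≤ δ * ‖x - y‖) (hv : ‖v - y‖ ≤ δ * ‖x - y‖) :
    ε / 2 * ‖x - y‖ ^ α ≤ |φ u - φ v| := by
  have hd : 0 < ‖x - y‖ := norm_pos_iff.2 (sub_ne_zero.2 hxy)
  rw [holderQuotient, le_div_iff₀ (by positivity)] at hq
  have key : ∀ a b : EuclideanSpace ℝ (Fin N), ‖a - b‖ ≤ δ * ‖x - y‖ →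
      |φ a - φ b| ≤ ε / 4 * ‖x - y‖ ^ α := fun a b hab =>
    calc |φ a - φ b| ≤ H * ‖a - b‖ ^ α := hφ a b
      _ ≤ H * (δ * ‖x - y‖) ^ α := by gcongr
      _ = H * δ ^ α * ‖x - y‖ ^ α := by rw [Real.mul_rpow hδ.le hd.le]; ring
      _ ≤ _ := by gcongr
  have h1 := abs_le.1 (key u x hu)
  have h2 := abs_le.1 (key v y hv)
  rcases le_abs.1 hq with h | h
  · exact le_trans (by linarith) (le_abs_self _)
  · exact le_trans (by linarith) (neg_le_abs _)

/-! ### Confinement for the Gagliardo seminorm -/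

theorem confined_of_gagliardoSeminorm_lt_top {N : ℕ} {s p : ℝ} (hp : 0 < p)
    (hsp : (N : ℝ) < s * p) {φ : EuclideanSpace ℝ (Fin N) → ℝ}
    (hH : holderSeminorm (alphaExp N s p) φ < ⊤) (hE : gagliardoSeminorm s p φ < ⊤)
    {ε : ℝ} (hε : 0 < ε) :
    ∃ R > 0, ∀ x y, x ≠ y → ε ≤ holderQuotient (alphaExp N s p) φ x y →
      1 / R ≤ ‖x - y‖ ∧ ‖x - y‖ ≤ R ∧ ‖x‖ ≤ R := by
  have hα : 0 < alphaExp N s p := by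
    rw [alphaExp, sub_pos, div_lt_iff₀ hp]; exact hsp
  obtain ⟨δ, hδ, hδ4, hδH⟩ := exists_pos_le_quarter_mul_rpow_le
    (H := (holderSeminorm (alphaExp N s p) φ).toReal) hα (by positivity : 0 < ε / 4)
  set G : EuclideanSpace ℝ (Fin N) × EuclideanSpace ℝ (Fin N) → ℝ≥0∞ := fun z =>
    ENNReal.ofReal (|φ z.1 - φ z.2| ^ p / ‖z.1 - z.2‖ ^ (N + s * p)) with hG
  have hGi : ∫⁻ z, G z ≠ ⊤ := by
    intro h
    rw [gagliardoSeminorm, h, ENNReal.top_rpow_of_pos (by positivity)] at hE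
    exact hE.ne rfl
  set ν := (volume : Measure (EuclideanSpace ℝ (Fin N) × EuclideanSpace ℝ (Fin N))).withDensity G
    with hν
  have : IsFiniteMeasure ν := isFiniteMeasure_withDensity hGi
  set κ : ℝ := (ε / 2) ^ p / 2 ^ (N + s * p) with hκ
  have hκ0 : 0 < κ := by positivity
  set V := volume (Metric.ball (0 : EuclideanSpace ℝ (Fin N)) 1) with hV
  have hV0 : V ≠ 0 := (Metric.measure_ball_pos _ _ one_pos).ne'
  set c : ℝ≥0∞ := ENNReal.ofReal (κ * (δ ^ N) ^ 2) * V ^ 2 with hcdef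
  have hc0 : 0 < c := by
    refine pos_iff_ne_zero.2 (mul_ne_zero ?_ (pow_ne_zero _ hV0))
    exact (ENNReal.ofReal_pos.2 (by positivity)).ne'
  obtain ⟨R, hR, hRc⟩ := exists_measure_ge_lt ν
    (f := fun z => ‖z.1 - z.2‖ + ‖z.1 - z.2‖⁻¹ + ‖z.1‖)
    (by fun_prop : Measurable fun z : EuclideanSpace ℝ (Fin N) × EuclideanSpace ℝ (Fin N) =>
      ‖z.1 - z.2‖ + ‖z.1 - z.2‖⁻¹ + ‖z.1‖).aemeasurable hc0
  refine ⟨4 * R, by positivity, fun x y hxy hq => ?_⟩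
  have hd : 0 < ‖x - y‖ := norm_pos_iff.2 (sub_ne_zero.2 hxy)
  set d := ‖x - y‖ with hdd
  set A := Metric.ball x (δ * d) ×ˢ Metric.ball y (δ * d) with hA
  have hAd : ∀ z ∈ A, d / 2 ≤ ‖z.1 - z.2‖ ∧ ‖z.1 - z.2‖ ≤ 2 * d ∧ ‖x‖ ≤ ‖z.1‖ + d := by
    rintro ⟨u, v⟩ ⟨hu, hv⟩
    simp only [mem_ball_iff_norm] at hu hv ⊢
    have h1 : δ * d ≤ d / 4 := by nlinarith
    have h2 : ‖u - v‖ ≤ ‖u - x‖ + ‖x - y‖ + ‖v - y‖ := by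
      have := norm_sub_le_norm_sub_add_norm_sub u x v
      have := norm_sub_le_norm_sub_add_norm_sub x y v
      rw [norm_sub_rev y v] at this; linarith
    have h3 : ‖x - y‖ ≤ ‖u - x‖ + ‖u - v‖ + ‖v - y‖ := by
      have := norm_sub_le_norm_sub_add_norm_sub x u y
      have := norm_sub_le_norm_sub_add_norm_sub u v y
      rw [norm_sub_rev x u] at *; linarith
    have h4 : ‖x‖ ≤ ‖u‖ + ‖u - x‖ := by simpa using norm_sub_le u (u - x)
    refine ⟨by linarith, by linarith, by linarith⟩
  -- On `A` the density is at least `κ * d ^ (-2 N)`, and the volume of `A` is a multiple of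
  -- `d ^ (2 N)`, so `A` carries mass at least `c`, independently of `d`.
  have hmass : c ≤ ν A := by
    have hlow : ∀ z ∈ A, ENNReal.ofReal (κ / (d ^ N) ^ 2) ≤ G z := by
      intro z hz
      obtain ⟨h1, h2, -⟩ := hAd z hz
      have h3 : ε / 2 * d ^ alphaExp N s p ≤ |φ z.1 - φ z.2| :=
        le_abs_sub_of_mem_ball hα ENNReal.toReal_nonneg (abs_sub_le_of_holderSeminorm_lt_top hH)
          hδ hδH hxy hq (mem_ball_iff_norm.1 hz.1).le (mem_ball_iff_norm.1 hz.2).le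
      refine ENNReal.ofReal_le_ofReal ?_
      have hexp : (0 : ℝ) ≤ N + s * p := by
        have : (0 : ℝ) ≤ N := Nat.cast_nonneg N
        linarith
      have hz0 : 0 < ‖z.1 - z.2‖ := by linarith
      calc κ / (d ^ N) ^ 2 = (ε / 2 * d ^ alphaExp N s p) ^ p / (2 * d) ^ (N + s * p) := by
            rw [Real.mul_rpow (by positivity) (by positivity), ← Real.rpow_mul hd.le,
              Real.mul_rpow (by norm_num) hd.le, hκ, div_div, mul_div_mul_comm,
              ← Real.rpow_sub hd, div_mul_eq_div_div, div_eq_mul_inv]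
            congr 1
            rw [← pow_mul, ← Real.rpow_natCast, ← Real.rpow_neg hd.le]
            congr 1
            rw [alphaExp]; push_cast; field_simp; ring
        _ ≤ _ := by gcongr
    calc c = ENNReal.ofReal (κ / (d ^ N) ^ 2) * volume A := by
          rw [Measure.volume_eq_prod, hA, Measure.prod_prod,
            Measure.addHaar_ball_of_pos _ x (by positivity),
            Measure.addHaar_ball_of_pos _ y (by positivity), finrank_euclideanSpace_fin, hcdef]
          rw [mul_mul_mul_comm, ← ENNReal.ofReal_mul (by positivity), ← mul_assoc,
            ← ENNReal.ofReal_mul (by positivity), ← hV, ← pow_two V]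
          congr 2
          rw [mul_pow]; field_simp
      _ = ∫⁻ _ in A, ENNReal.ofReal (κ / (d ^ N) ^ 2) := by rw [setLIntegral_const]
      _ ≤ ∫⁻ z in A, G z :=
          setLIntegral_mono' (measurableSet_ball.prod measurableSet_ball) hlow
      _ = ν A := by
          rw [hν, withDensity_apply _ (measurableSet_ball.prod measurableSet_ball)]
  obtain ⟨z, hzA, hzR⟩ := not_subset.1 fun h =>
    (hmass.trans (measure_mono h)).not_gt hRc
  obtain ⟨h1, h2, h3⟩ := hAd z hzA
  simp only [mem_ofPred_eq, not_le] at hzR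
  have hz0 : 0 < ‖z.1 - z.2‖ := by linarith
  have h4 : 0 < ‖z.1 - z.2‖⁻¹ := by positivity
  have h5 := norm_nonneg z.1
  have h6 : 1 ≤ R * ‖z.1 - z.2‖ := by
    rw [← inv_le_iff_one_le_mul₀ hz0]; linarith
  refine ⟨?_, by linarith, by linarith⟩
  rw [div_le_iff₀ (by positivity)]
  nlinarith

/-! ### Mollification and weak gradients -/

/-- The integration by parts of `IsWeakGradient`, for derivatives in an arbitrary direction. -/
theorem IsWeakGradient.integral_mul_fderiv {N : ℕ} {φ : EuclideanSpace ℝ (Fin N) → ℝ}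
    {g : EuclideanSpace ℝ (Fin N) → EuclideanSpace ℝ (Fin N)} (h : IsWeakGradient φ g)
    {ψ : EuclideanSpace ℝ (Fin N) → ℝ} (hψ : ContDiff ℝ ∞ ψ) (hψc : HasCompactSupport ψ)
    (v : EuclideanSpace ℝ (Fin N)) :
    ∫ x, φ x * fderiv ℝ ψ x v = - ∫ x, inner ℝ (g x) v * ψ x := by
  obtain ⟨hφ, hg, hw⟩ := h
  have hv : v = ∑ i, v i • EuclideanSpace.single i (1 : ℝ) := by
    ext j; simp [Pi.single_apply]
  have h1 : ∀ x, φ x * fderiv ℝ ψ x v =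
      ∑ i, v i * (φ x * fderiv ℝ ψ x (EuclideanSpace.single i 1)) := by
    intro x
    conv_lhs => rw [hv]
    simp only [map_sum, map_smul, smul_eq_mul, Finset.mul_sum]
    exact Finset.sum_congr rfl fun i _ => by ring
  have h2 : ∀ x, inner ℝ (g x) v * ψ x = ∑ i, v i * (g x i * ψ x) := by
    intro x
    rw [PiLp.inner_apply, Finset.sum_mul]
    exact Finset.sum_congr rfl fun i _ => by simp; ring
  have hdc : ∀ w, Continuous fun x => fderiv ℝ ψ x w := fun w =>
    (hψ.continuous_fderiv (by simp)).clm_apply continuous_const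
  have hi1 : ∀ i, Integrable fun x => φ x * fderiv ℝ ψ x (EuclideanSpace.single i 1) := fun i => by
    refine hφ.integrable_smul_right_of_hasCompactSupport (hdc _) ?_
    exact (hψc.fderiv (𝕜 := ℝ)).comp_left
      (g := fun L : EuclideanSpace ℝ (Fin N) →L[ℝ] ℝ => L (EuclideanSpace.single i 1)) rfl
  have hi2 : ∀ i, Integrable fun x => g x i * ψ x := fun i => by
    have := (hg.integrable_smul_left_of_hasCompactSupport hψ.continuous hψc)
    refine ((EuclideanSpace.proj (𝕜 := ℝ) i).integrable_comp this).congr (ae_of_all _ fun x => ?_)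
    simp [mul_comm]
  simp_rw [h1, h2]
  rw [integral_finsetSum _ fun i _ => (hi1 i).const_mul _,
    integral_finsetSum _ fun i _ => (hi2 i).const_mul _, ← Finset.sum_neg_distrib]
  refine Finset.sum_congr rfl fun i _ => ?_
  rw [integral_const_mul, integral_const_mul, hw ψ hψ hψc i, mul_neg]

/-- The derivative of the convolution with a test function is the convolution of that function with
the weak gradient. -/
theorem IsWeakGradient.hasFDerivAt_convolution {N : ℕ} {φ : EuclideanSpace ℝ (Fin N) → ℝ}
    {g : EuclideanSpace ℝ (Fin N) → EuclideanSpace ℝ (Fin N)} (h : IsWeakGradient φ g)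
    {ψ : EuclideanSpace ℝ (Fin N) → ℝ} (hψ : ContDiff ℝ ∞ ψ) (hψc : HasCompactSupport ψ)
    (z : EuclideanSpace ℝ (Fin N)) :
    ∃ D : EuclideanSpace ℝ (Fin N) →L[ℝ] ℝ,
      HasFDerivAt (convolution ψ φ (ContinuousLinearMap.lsmul ℝ ℝ) volume) D z ∧
      ∀ v, D v = ∫ w, inner ℝ (g w) v * ψ (z - w) := by
  have hψ1 : ContDiff ℝ 1 ψ := hψ.of_le (by simp)
  have hd := hψc.hasFDerivAt_convolution_right (μ := volume)
    (ContinuousLinearMap.lsmul ℝ ℝ).flip h.1 hψ1 z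
  rw [convolution_flip] at hd
  refine ⟨_, hd, fun v => ?_⟩
  rw [convolution_precompR_apply _ h.1 (hψc.fderiv (𝕜 := ℝ)) (hψ1.continuous_fderiv (by simp))]
  have hs : ContDiff ℝ ∞ fun w => ψ (z - w) := hψ.comp (by fun_prop)
  have hsc : HasCompactSupport fun w => ψ (z - w) :=
    hψc.comp_homeomorph (Homeomorph.subLeft z)
  have hw := h.integral_mul_fderiv hs hsc v
  rw [← neg_eq_iff_eq_neg, ← integral_neg] at hw
  rw [← hw, convolution_def]
  refine integral_congr_ae (ae_of_all _ fun w => ?_)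
  have hc : fderiv ℝ (fun w => ψ (z - w)) w v = - fderiv ℝ ψ (z - w) v := by
    have h1 : HasFDerivAt (fun w => z - w) (-ContinuousLinearMap.id ℝ _) w := by
      simpa using (hasFDerivAt_id w).const_sub z
    have h2 := ((hψ1.differentiable (by simp)) (z - w)).hasFDerivAt.comp w h1
    rw [show (fun w => ψ (z - w)) = ψ ∘ fun w => z - w from rfl, h2.fderiv]
    simp
  simp only [hc, ContinuousLinearMap.flip_apply, ContinuousLinearMap.lsmul_apply, smul_eq_mul]
  ring

/-- The first term on the right is the cost of replacing `φ` by its mollification at scale `r`, the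
second is the mean value inequality for the mollification along the segment from `x` to `y`. -/
theorem IsWeakGradient.abs_sub_le {N : ℕ} {φ : EuclideanSpace ℝ (Fin N) → ℝ}
    {g : EuclideanSpace ℝ (Fin N) → EuclideanSpace ℝ (Fin N)} (h : IsWeakGradient φ g)
    {α H r : ℝ} (hα : 0 < α) (hH : 0 ≤ H) (hφ : ∀ x y, |φ x - φ y| ≤ H * ‖x - y‖ ^ α)
    (hr : 0 < r) (x y : EuclideanSpace ℝ (Fin N)) :
    |φ x - φ y| ≤ 2 * (H * r ^ α) +
      2 ^ N / (r ^ N * volume.real (Metric.ball (0 : EuclideanSpace ℝ (Fin N)) 1)) *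
        (∫ w in Metric.closedBall x (‖x - y‖ + r), ‖g w‖) * ‖x - y‖ := by
  set b : ContDiffBump (0 : EuclideanSpace ℝ (Fin N)) := ⟨r / 2, r, by positivity, by linarith⟩
  set ψ := b.normed volume with hψdef
  set M := 2 ^ N / (r ^ N * volume.real (Metric.ball (0 : EuclideanSpace ℝ (Fin N)) 1))
  have hM : ∀ w, ψ w ≤ M := fun w => by
    have := b.normed_le_div_measure_closedBall_rOut volume 2
      (by change r ≤ 2 * (r / 2); linarith) w
    rwa [Measure.addHaar_real_closedBall _ _ b.rOut_pos.le, finrank_euclideanSpace_fin] at this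
  have hM0 : 0 ≤ M := (b.nonneg_normed 0).trans (hM 0)
  set Φ := convolution ψ φ (ContinuousLinearMap.lsmul ℝ ℝ) volume
  have hΦ : ∀ z, |Φ z - φ z| ≤ H * r ^ α := fun z => by
    refine b.dist_normed_convolution_le (μ := volume) h.1.aestronglyMeasurable fun w hw => ?_
    refine (hφ w z).trans ?_
    have : ‖w - z‖ ≤ r := (mem_ball_iff_norm.1 hw).le
    gcongr
  set B := Metric.closedBall x (‖x - y‖ + r)
  have hgB : IntegrableOn (fun w => ‖g w‖) B :=
    (h.2.1.integrableOn_isCompact (isCompact_closedBall _ _)).norm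
  have hlip : ‖Φ y - Φ x‖ ≤ (M * ∫ w in B, ‖g w‖) * ‖y - x‖ := by
    choose D hD hDv using h.hasFDerivAt_convolution (ψ := ψ) b.contDiff_normed
      b.hasCompactSupport_normed
    refine (convex_closedBall x ‖x - y‖).norm_image_sub_le_of_norm_hasFDerivWithin_le
      (f' := D) (fun z _ => (hD z).hasFDerivWithinAt) (fun z hz => ?_)
      (Metric.mem_closedBall_self (norm_nonneg _)) (by simp [dist_eq_norm, norm_sub_rev])
    refine ContinuousLinearMap.opNorm_le_bound _
      (mul_nonneg hM0 (integral_nonneg fun _ => norm_nonneg _)) fun v => ?_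
    rw [hDv z v, mul_right_comm, ← integral_const_mul, ← integral_indicator measurableSet_closedBall]
    refine norm_integral_le_of_norm_le ((integrable_indicator_iff measurableSet_closedBall).2
      (hgB.const_mul _)) (ae_of_all _ fun w => ?_)
    -- The kernel vanishes for `w` outside `B`, where `r < ‖z - w‖`.
    by_cases hw : w ∈ B
    · rw [indicator_of_mem hw, norm_mul, Real.norm_of_nonneg (b.nonneg_normed _)]
      calc _ ≤ (‖g w‖ * ‖v‖) * M := by
            gcongr
            · exact b.nonneg_normed _
            · exact norm_inner_le_norm _ _
            · exact hM _
        _ = _ := by ring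
    · rw [indicator_of_notMem hw]
      have : ψ (z - w) = 0 := by
        by_contra hne
        have hm : z - w ∈ Function.support ψ := hne
        rw [hψdef, b.support_normed_eq, mem_ball_zero_iff] at hm
        apply hw
        rw [Metric.mem_closedBall, dist_eq_norm] at hz ⊢
        have := norm_sub_le_norm_sub_add_norm_sub w z x
        rw [norm_sub_rev w z] at this
        have hm' : ‖z - w‖ < r := hm
        linarith
      simp [this]
  rw [Real.norm_eq_abs, norm_sub_rev y x] at hlip
  have h1 := abs_le.1 (hΦ x)
  have h2 := abs_le.1 (hΦ y)
  have h3 := abs_le.1 hlip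
  rw [abs_le]
  constructor <;> linarith

/-! ### Confinement for the gradient seminorm -/

/-- For `f` in `L^p`, the quantity `d ^ (N / p - N) * ∫ f` over `B(x, 2 d)` tends to zero as `d → 0`,
as `d → ∞`, and as `‖x‖ → ∞` with `d` bounded. -/
theorem confined_of_le_lintegral_closedBall {N : ℕ} (hN : 1 ≤ N) {p : ℝ} (hp : 1 < p)
    {f : EuclideanSpace ℝ (Fin N) → ℝ} (hf : Measurable f) (hf0 : 0 ≤ f)
    (hfp : ∫⁻ w, ENNReal.ofReal (f w ^ p) ≠ ⊤) {c : ℝ} (hc : 0 < c) :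
    ∃ R > 0, ∀ (x : EuclideanSpace ℝ (Fin N)) (d : ℝ), 0 < d →
      ENNReal.ofReal (c * d ^ (N - N / p : ℝ)) ≤
        ∫⁻ w in Metric.closedBall x (2 * d), ENNReal.ofReal (f w) →
      1 / R ≤ d ∧ d ≤ R ∧ ‖x‖ ≤ R := by
  have hp0 : 0 < p := by linarith
  have hN0 : (0 : ℝ) < N := by exact_mod_cast hN
  set ν := (volume : Measure (EuclideanSpace ℝ (Fin N))).withDensity
    (fun w => ENNReal.ofReal (f w ^ p)) with hν
  have : IsFiniteMeasure ν := isFiniteMeasure_withDensity hfp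
  set V := volume.real (Metric.ball (0 : EuclideanSpace ℝ (Fin N)) 1) with hV
  have hV0 : 0 < V := ENNReal.toReal_pos (Metric.measure_ball_pos _ _ one_pos).ne'
    measure_ball_lt_top.ne
  have hball : ∀ (x : EuclideanSpace ℝ (Fin N)) (ρ : ℝ), 0 < ρ →
      volume (Metric.closedBall x ρ) = ENNReal.ofReal (ρ ^ N * V) := fun x ρ hρ => by
    rw [Measure.addHaar_closedBall _ _ hρ.le, finrank_euclideanSpace_fin,
      ENNReal.ofReal_mul (by positivity), hV, ofReal_measureReal measure_ball_lt_top.ne]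
  -- Mass `c₁` contributes at most `c / 2 * d ^ (N - N / p)` to the integral in Hölder's inequality.
  set c₁ : ℝ := (c / 2 / (2 ^ N * V) ^ (1 - 1 / p)) ^ p with hc₁
  have hc₁0 : 0 < c₁ := by positivity
  set τ : EuclideanSpace ℝ (Fin N) → ℝ := fun w => ‖w‖ + f w with hτ
  have hτm : Measurable τ := measurable_norm.add hf
  obtain ⟨R, hR, hRc⟩ := exists_measure_ge_lt ν hτm.aemeasurable (ENNReal.ofReal_pos.2 hc₁0)
  set T := {w | R ≤ τ w} with hT
  have hTm : MeasurableSet T := measurableSet_le measurable_const hτm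
  set a : ℝ := N - N / p with ha
  have ha0 : 0 < a := by
    rw [ha, sub_pos, div_lt_iff₀ hp0]; nlinarith
  -- The part of `f` on `T` is controlled by Hölder's inequality, hence is less than half of the
  -- lower bound; on the complement of `T` both `f` and the norm of the point are at most `R`.
  have key : ∀ (x : EuclideanSpace ℝ (Fin N)) (d : ℝ), 0 < d →
      ENNReal.ofReal (c * d ^ a) ≤
        ∫⁻ w in Metric.closedBall x (2 * d), ENNReal.ofReal (f w) →
      c / 2 * d ^ a ≤
        R * volume.real (Metric.closedBall x (2 * d) ∩ Metric.closedBall 0 R) := by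
    intro x d hd hle
    set B := Metric.closedBall x (2 * d) with hB
    have hin : ∫⁻ w in B ∩ T, ENNReal.ofReal (f w) ≤ ENNReal.ofReal (c / 2 * d ^ a) := by
      have hpq : p.HolderConjugate (p / (p - 1)) := Real.HolderConjugate.conjExponent hp
      have hol := ENNReal.lintegral_mul_le_Lp_mul_Lq (volume.restrict (B ∩ T)) hpq
        (f := fun w => ENNReal.ofReal (f w)) (g := fun _ => 1)
        hf.ennreal_ofReal.aemeasurable aemeasurable_const
      simp only [Pi.mul_apply, mul_one, ENNReal.one_rpow, lintegral_const, one_mul,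
        Measure.restrict_apply_univ] at hol
      refine hol.trans ?_
      have e1 : 1 / (p / (p - 1)) = 1 - 1 / p := by
        have : p - 1 ≠ 0 := by linarith
        field_simp
      have e0 : 0 ≤ 1 - 1 / p := by
        rw [sub_nonneg, div_le_one hp0]; exact hp.le
      have i1 : ∫⁻ w in B ∩ T, ENNReal.ofReal (f w) ^ p ≤ ENNReal.ofReal c₁ := by
        refine le_trans ?_ hRc.le
        rw [hν, withDensity_apply _ hTm]
        simp_rw [fun w => ENNReal.ofReal_rpow_of_nonneg (hf0 w) hp0.le]
        exact lintegral_mono_set inter_subset_right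
      have i2 : volume (B ∩ T) ≤ ENNReal.ofReal ((2 * d) ^ N * V) :=
        (measure_mono inter_subset_left).trans (hball x _ (by positivity)).le
      calc _ ≤ ENNReal.ofReal c₁ ^ (1 / p) *
            ENNReal.ofReal ((2 * d) ^ N * V) ^ (1 - 1 / p) := by
            rw [e1]; gcongr
        _ = ENNReal.ofReal (c₁ ^ (1 / p) * ((2 * d) ^ N * V) ^ (1 - 1 / p)) := by
            rw [ENNReal.ofReal_rpow_of_nonneg hc₁0.le (by positivity),
              ENNReal.ofReal_rpow_of_nonneg (by positivity) e0,
              ← ENNReal.ofReal_mul (by positivity)]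
        _ = _ := by
            congr 1
            rw [hc₁, ← Real.rpow_mul (by positivity), mul_one_div_cancel hp0.ne', Real.rpow_one,
              show (2 * d) ^ N * V = (2 ^ N * V) * d ^ N by ring,
              Real.mul_rpow (by positivity : 0 ≤ 2 ^ N * V) (by positivity),
              ← Real.rpow_natCast d N,
              ← Real.rpow_mul hd.le, ← mul_assoc, div_mul_cancel₀ _ (by positivity), ha]
            congr 2
            ring
    have hout : ∫⁻ w in B \ T, ENNReal.ofReal (f w) ≤
        ENNReal.ofReal (R * volume.real (B ∩ Metric.closedBall 0 R)) := by
      have hsub : ∀ w ∈ B \ T, f w ≤ R ∧ w ∈ B ∩ Metric.closedBall 0 R := by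
        rintro w ⟨hwB, hwT⟩
        have h1 : ‖w‖ + f w < R := not_le.1 hwT
        have h2 := hf0 w
        have h3 := norm_nonneg w
        simp only [Pi.zero_apply] at h2
        exact ⟨by linarith, hwB, mem_closedBall_zero_iff.2 (by linarith)⟩
      calc _ ≤ ∫⁻ _ in B \ T, ENNReal.ofReal R :=
            setLIntegral_mono' (measurableSet_closedBall.diff hTm)
              fun w hw => ENNReal.ofReal_le_ofReal (hsub w hw).1
        _ = ENNReal.ofReal R * volume (B \ T) := setLIntegral_const _ _
        _ ≤ ENNReal.ofReal R * volume (B ∩ Metric.closedBall 0 R) := by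
            gcongr; exact fun w hw => (hsub w hw).2
        _ = _ := by
            rw [ENNReal.ofReal_mul hR.le, ofReal_measureReal
              ((measure_mono inter_subset_left).trans_lt measure_closedBall_lt_top).ne]
    rw [← lintegral_inter_add_sdiff _ B hTm] at hle
    have h2 := hle.trans (add_le_add hin hout)
    rw [← ENNReal.ofReal_add (by positivity) (by positivity),
      ENNReal.ofReal_le_ofReal_iff (by positivity)] at h2
    linarith
  -- Bounding the intersection by its second ball gives `d ≤ D`, by its first ball `m ≤ d`.
  set D : ℝ := (R * (R ^ N * V) / (c / 2)) ^ a⁻¹ with hD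
  set m : ℝ := (c / 2 / (R * (2 ^ N * V))) ^ (N / p : ℝ)⁻¹ with hm
  have hD0 : 0 < D := by positivity
  have hm0 : 0 < m := by positivity
  refine ⟨2 * D + R + 1 / m, by positivity, fun x d hd hle => ?_⟩
  have hk := key x d hd hle
  have hdD : d ≤ D := by
    have h1 : volume.real (Metric.closedBall x (2 * d) ∩ Metric.closedBall 0 R) ≤ R ^ N * V := by
      refine ENNReal.toReal_le_of_le_ofReal (by positivity) ?_
      rw [← hball 0 R hR]; exact measure_mono inter_subset_right
    rw [hD, Real.le_rpow_inv_iff_of_pos hd.le (by positivity) ha0, le_div_iff₀ (by positivity)]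
    nlinarith
  have hmd : m ≤ d := by
    have h1 : volume.real (Metric.closedBall x (2 * d) ∩ Metric.closedBall 0 R) ≤
        (2 * d) ^ N * V := by
      refine ENNReal.toReal_le_of_le_ofReal (by positivity) ?_
      rw [← hball x (2 * d) (by positivity)]; exact measure_mono inter_subset_left
    rw [hm, Real.rpow_inv_le_iff_of_pos (by positivity) hd.le (by positivity),
      div_le_iff₀ (by positivity)]
    have h2 : c / 2 * d ^ a ≤ (d ^ (N / p : ℝ) * (R * (2 ^ N * V))) * d ^ a := by
      refine hk.trans ((mul_le_mul_of_nonneg_left h1 hR.le).trans_eq ?_)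
      have : d ^ N = d ^ (N / p : ℝ) * d ^ a := by
        rw [← Real.rpow_add hd, ha, ← Real.rpow_natCast]; congr 1; ring
      rw [mul_pow, this]; ring
    exact le_of_mul_le_mul_right h2 (by positivity)
  have hxR : ‖x‖ ≤ 2 * d + R := by
    obtain ⟨w, hw1, hw2⟩ : (Metric.closedBall x (2 * d) ∩ Metric.closedBall 0 R).Nonempty := by
      by_contra hne
      rw [not_nonempty_iff_eq_empty.1 hne, measureReal_empty, mul_zero] at hk
      exact hk.not_gt (by positivity)
    rw [mem_closedBall_zero_iff] at hw2
    rw [mem_closedBall_iff_norm] at hw1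
    have := norm_sub_le w (w - x)
    rw [sub_sub_cancel] at this
    linarith
  have hm1 : 0 < 1 / m := by positivity
  refine ⟨?_, by linarith, by linarith⟩
  rw [div_le_comm₀ (by positivity) hd]
  have : 1 / d ≤ 1 / m := one_div_le_one_div_of_le hm0 hmd
  linarith

theorem confined_of_gradientSeminorm_lt_top {N : ℕ} (hN : 1 ≤ N) {p : ℝ} (hp : 1 < p)
    (hNp : (N : ℝ) < p) {φ : EuclideanSpace ℝ (Fin N) → ℝ}
    (hH : holderSeminorm (alphaExp N 1 p) φ < ⊤) (hE : gradientSeminorm p φ < ⊤)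
    {ε : ℝ} (hε : 0 < ε) :
    ∃ R > 0, ∀ x y, x ≠ y → ε ≤ holderQuotient (alphaExp N 1 p) φ x y →
      1 / R ≤ ‖x - y‖ ∧ ‖x - y‖ ≤ R ∧ ‖x‖ ≤ R := by
  have hp0 : 0 < p := by linarith
  have hα : 0 < alphaExp N 1 p := by
    rw [alphaExp, sub_pos, div_lt_one hp0]; exact hNp
  obtain ⟨g, hE⟩ := iInf_lt_iff.1 hE
  obtain ⟨hg, hE⟩ := iInf_lt_iff.1 hE
  have hgp : ∫⁻ w, ENNReal.ofReal (‖g w‖ ^ p) ≠ ⊤ := by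
    intro h
    rw [h, ENNReal.top_rpow_of_pos (by positivity)] at hE
    exact hE.ne rfl
  obtain ⟨δ, hδ, hδ4, hδH⟩ := exists_pos_le_quarter_mul_rpow_le
    (H := (holderSeminorm (alphaExp N 1 p) φ).toReal) hα (by positivity : 0 < ε / 4)
  set V := volume.real (Metric.ball (0 : EuclideanSpace ℝ (Fin N)) 1) with hV
  have hV0 : 0 < V := ENNReal.toReal_pos (Metric.measure_ball_pos _ _ one_pos).ne'
    measure_ball_lt_top.ne
  -- A measurable representative of the norm of the gradient.
  have hgm := hg.2.1.aestronglyMeasurable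
  set f : EuclideanSpace ℝ (Fin N) → ℝ := fun w => ‖hgm.mk g w‖ with hf
  have hfg : ∀ᵐ w, ‖g w‖ = f w := hgm.ae_eq_mk.mono fun w hw => by simp only [hf, ← hw]
  have hfp : ∫⁻ w, ENNReal.ofReal (f w ^ p) ≠ ⊤ := by
    rwa [← lintegral_congr_ae (hfg.mono fun w hw => by simp only [hw] :
      (fun w => ENNReal.ofReal (‖g w‖ ^ p)) =ᵐ[volume] fun w => ENNReal.ofReal (f w ^ p))]
  obtain ⟨R, hR, hconf⟩ := confined_of_le_lintegral_closedBall hN hp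
    hgm.stronglyMeasurable_mk.norm.measurable (fun w => norm_nonneg _) hfp
    (by positivity : 0 < ε / 2 * (δ ^ N * V / 2 ^ N))
  refine ⟨R, hR, fun x y hxy hq => hconf x ‖x - y‖ (norm_pos_iff.2 (sub_ne_zero.2 hxy)) ?_⟩
  have hd : 0 < ‖x - y‖ := norm_pos_iff.2 (sub_ne_zero.2 hxy)
  rw [holderQuotient, le_div_iff₀ (by positivity)] at hq
  have hmor := hg.abs_sub_le hα ENNReal.toReal_nonneg (abs_sub_le_of_holderSeminorm_lt_top hH)
    (by positivity : 0 < δ * ‖x - y‖) x y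
  set d := ‖x - y‖ with hdd
  have hint : ∀ ρ, IntegrableOn (fun w => ‖g w‖) (Metric.closedBall x ρ) := fun ρ =>
    (hg.2.1.integrableOn_isCompact (isCompact_closedBall _ _)).norm
  have hmono : ∫ w in Metric.closedBall x (d + δ * d), ‖g w‖ ≤
      ∫ w in Metric.closedBall x (2 * d), ‖g w‖ :=
    setIntegral_mono_set (hint _) (ae_of_all _ fun _ => norm_nonneg _)
      (Metric.closedBall_subset_closedBall (by nlinarith)).eventuallyLE
  rw [← lintegral_congr_ae (ae_restrict_of_ae (hfg.mono fun w hw => by simp only [hw]) :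
      (fun w => ENNReal.ofReal ‖g w‖) =ᵐ[volume.restrict (Metric.closedBall x (2 * d))]
        fun w => ENNReal.ofReal (f w)),
    ← ofReal_integral_eq_lintegral_ofReal (hint _) (ae_of_all _ fun _ => norm_nonneg _)]
  refine ENNReal.ofReal_le_ofReal (le_trans ?_ hmono)
  set I := ∫ w in Metric.closedBall x (d + δ * d), ‖g w‖
  have h1 : 2 * ((holderSeminorm (alphaExp N 1 p) φ).toReal * (δ * d) ^ alphaExp N 1 p) ≤
      ε / 2 * d ^ alphaExp N 1 p := by
    rw [Real.mul_rpow hδ.le hd.le]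
    have : 0 < d ^ alphaExp N 1 p := by positivity
    nlinarith
  have h2 : ε / 2 * d ^ alphaExp N 1 p ≤ 2 ^ N / ((δ * d) ^ N * V) * I * d := by linarith
  have h3 : d ^ alphaExp N 1 p * d ^ N = d ^ (N - N / p : ℝ) * d := by
    rw [← Real.rpow_natCast, ← Real.rpow_add hd, ← Real.rpow_add_one hd.ne', alphaExp]
    congr 1; ring
  have h4 : ε / 2 * (δ ^ N * V / 2 ^ N) * d ^ (N - N / p : ℝ) * d ≤ I * d := by
    calc _ = ε / 2 * d ^ alphaExp N 1 p * (d ^ N * δ ^ N * V / 2 ^ N) := by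
          linear_combination (-(ε / 2 * (δ ^ N * V / 2 ^ N))) * h3
      _ ≤ 2 ^ N / ((δ * d) ^ N * V) * I * d * (d ^ N * δ ^ N * V / 2 ^ N) := by gcongr
      _ = I * d := by rw [mul_pow]; field_simp
  exact le_of_mul_le_mul_right h4 hd

/-! ### Attainment in the homogeneous Sobolev space -/

theorem theorem5p4 (N : ℕ) (hN : 1 ≤ N) (s p : ℝ) (hs0 : 0 < s) (hs1 : s ≤ 1)
    (hp : 1 < p) (hsp : (N : ℝ) < s * p)
    (φ : EuclideanSpace ℝ (Fin N) → ℝ) (hφ : φ ∈ homSobolevSpace N s p) :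
    ∃ x₀ y₀ : EuclideanSpace ℝ (Fin N), x₀ ≠ y₀ ∧
      holderSeminorm (alphaExp N s p) φ =
        ENNReal.ofReal (holderQuotient (alphaExp N s p) φ x₀ y₀) := by
  obtain ⟨⟨hc, hH⟩, hE⟩ := hφ
  refine exists_holderSeminorm_eq_of_confined hN hc fun ε hε => ?_
  rw [sobolevSeminorm] at hE
  split_ifs at hE with hs
  · subst hs
    exact confined_of_gradientSeminorm_lt_top hN hp (by simpa using hsp) hH hE hε
  · exact confined_of_gagliardoSeminorm_lt_top (by linarith) hsp hH hE hε
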